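/- Let $X=\{0,1\}^*$ be the set of finite binary sequences, and let $|p|$ be the length of $p\in X$. A computer is a partial recursive function $C\colon X\to X$ whose domain $\operatorname{Dom} C$ is prefix-free (no element of it is a proper prefix of another). Let $U$ be an optimal computer, i.e. a computer such that for every computer $C$ there is a constant $\mathrm{sim}(C)\in\mathbb{N}$ such that for every $p\in\operatorname{Dom} C$ there is a $q$ with $U(q)=C(p)$ and $|q|\le|p|+\mathrm{sim}(C)$. For $s\in X$ let $H(s)=\min\{|p| : U(p)=s\}$. For a real number $x$ and $n\in\mathbb{N}$, let $x_n\in X$ be the sequence of the first $n$ digits after the binary point of the base-two expansion, with infinitely many zeros, of $x-\lfloor x\rfloor$. A real number $D$ is called computable if there is a total recursive function that generates the digits of a base-two expansion of $D-\lfloor D\rfloor$. For real $D>0$ put $$\Omega^D=\sum_{p\in\operatorname{Dom} U}2^{-|p|/D}.$$ (a) If $0<D\le 1$ and $D$ is computable, then the series $\Omega^D$ converges, and $\Omega^D$ is weakly Chaitin $D$-random, i.e. there is a $c\in\mathbb{R}$ such that $H((\Omega^D)_n)\ge Dn-c$ for all $n\in\mathbb{N}$, and $D$-compressible, i.e. there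 is a function $f\colon\mathbb{N}\to\mathbb{R}$ with $\lim_{n\to\infty}f(n)/n=0$ such that $H((\Omega^D)_n)\le Dn+f(n)$ for all $n\in\mathbb{N}$. (b) If $D>1$, then the series $\Omega^D$ diverges to infinity. -/

import Mathlib

open Filter Topology
open scoped ENNReal

namespace AlgInfo

/-- A set of finite binary sequences is prefix-free if no element is a prefix of another one. -/
def PrefixFree (S : Set (List Bool)) : Prop :=
  ∀ p ∈ S, ∀ q ∈ S, p <+: q → p = q

/-- A computer: a partial recursive function on finite binary sequences with prefix-free domain. -/
def IsComputer (C : List Bool →. List Bool) : Prop :=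
  Partrec C ∧ PrefixFree C.Dom

/-- An optimal computer: it simulates every computer with at most a constant increase
in program length. -/
def IsOptimalComputer (U : List Bool →. List Bool) : Prop :=
  IsComputer U ∧
    ∀ C : List Bool →. List Bool, IsComputer C →
      ∃ sim : ℕ, ∀ p s : List Bool, s ∈ C p →
        ∃ q : List Bool, s ∈ U q ∧ q.length ≤ p.length + sim

/-- The program-size complexity `H_C(s)`: the least length of a program `p` with `C(p) = s`
(the value is `⊤` if there is none). -/
noncomputable def complexity (C : List Bool →. List Bool) (s : List Bool) : ℕ∞ :=
  ⨅ (p : List Bool) (_ : s ∈ C p), (p.length : ℕ∞)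

/-- The prefix of length `n` of an infinite binary sequence. -/
def pre (α : ℕ → Bool) (n : ℕ) : List Bool :=
  List.ofFn fun i : Fin n => α i

/-- The base-two digits after the binary point of `x mod 1`, in the expansion with infinitely
many zeros (`Real.digits` takes the digit of index `i` from `⌊x * 2 ^ (i + 1)⌋`). -/
noncomputable def code (x : ℝ) : ℕ → Bool :=
  fun i => decide (Real.digits (Int.fract x) 2 i = 1)

/-- `D` is computable if a total recursive function generates a base-two expansion
of `D mod 1`. -/
def IsComputableReal (D : ℝ) : Prop :=
  ∃ f : ℕ → Fin 2, Computable f ∧ Real.ofDigits f = Int.fract D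

/-- `α` is weakly Chaitin `D`-random: `D n - c ≤ H(α_n)` for some real `c` and all `n`. -/
def WeaklyChaitinRandom (U : List Bool →. List Bool) (D : ℝ) (α : ℕ → Bool) : Prop :=
  ∃ c : ℝ, ∀ n : ℕ,
    ((D * n - c : ℝ) : EReal) ≤ (((complexity U (pre α n) : ℕ∞) : ℝ≥0∞) : EReal)

/-- `α` is `D`-compressible: `H(α_n) ≤ D n + o(n)`. -/
def Compressible (U : List Bool →. List Bool) (D : ℝ) (α : ℕ → Bool) : Prop :=
  ∃ f : ℕ → ℝ, Tendsto (fun n : ℕ => f n / n) atTop (𝓝 0) ∧ ∀ n : ℕ,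
    (((complexity U (pre α n) : ℕ∞) : ℝ≥0∞) : EReal) ≤ ((D * n + f n : ℝ) : EReal)

/-- The generalized halting probability: the sum of `2 ^ (-|p| / D)` over all `p` in the domain
of `U`, with value `⊤` if the series of nonnegative terms diverges. -/
noncomputable def omega (U : List Bool →. List Bool) (D : ℝ) : ℝ≥0∞ :=
  ∑' p : U.Dom, ENNReal.ofReal ((2 : ℝ) ^ (-((p : List Bool).length : ℝ) / D))

end AlgInfo

namespace AlgInfo

/-! For `D ≤ 1` each term is at most `2 ^ (-|p|)`, so the series converges by Kraft's inequality.

Randomness is Chaitin's argument. The first `n` digits of Ω^D determine a stage of the enumeration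
of `U` after which less than `2 * 2 ^ (-n)` of the sum is missing (`IsEnumeration.exists_stage`). A
word not yet output at that stage is computable from any program for these digits, yet its programs
in `U` halt later, so each weighs less than `2 * 2 ^ (-n)` and has length above `D (n - 1)`.

Compressibility uses the superadditivity of `x ^ (1 / D)`: a tail of Ω^D is at most the `1 / D`-th
power of the same tail of Ω^1 (`omega_sub_sum_le`). About `D n` digits of Ω^1 thus yield a stage
that gives Ω^D to within `O(2 ^ (-n))`; a bounded correction and a header of `O(√n)` bits complete
the program (`IsOptimalComputer.exists_program`).

For `D > 1`, every word of length `n` has a program of length `n + O(√n)`; these `2 ^ n` programs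
contribute at least `2 ^ (n (1 - 1 / D) - O(√n))`, which is unbounded. -/

/-! ### Primitive recursive tools and the enumeration of a computer in stages. -/

theorem primrec_pow : Primrec₂ ((· ^ ·) : ℕ → ℕ → ℕ) :=
  Primrec₂.unpaired'.1 Nat.Primrec.pow

theorem primrec_replicate {α : Type*} [Primcodable α] (a : α) :
    Primrec fun n : ℕ => List.replicate n a :=
  (Primrec.list_map Primrec.list_range ((Primrec.const a).to₂ : Primrec₂ fun _ _ => a)).of_eq
    fun n => by simp

theorem primrec_list_sum : Primrec fun l : List ℕ => l.sum :=
  (Primrec.list_foldr Primrec.id (Primrec.const 0)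
    ((Primrec.nat_add.comp (Primrec.fst.comp Primrec.snd)
      (Primrec.snd.comp Primrec.snd)).to₂)).of_eq fun l => by
    induction l <;> simp_all

/-- `R` enumerates the graph of `U` in stages. -/
structure IsEnumeration (U : List Bool →. List Bool)
    (R : ℕ → List (List Bool × List Bool)) : Prop where
  primrec : Primrec R
  nodup : ∀ t, ((R t).map Prod.fst).Nodup
  sound : ∀ t, ∀ x ∈ R t, x.2 ∈ U x.1
  complete : ∀ p s, s ∈ U p → ∃ t₀, ∀ t, t₀ ≤ t → (p, s) ∈ R t

theorem exists_isEnumeration {U : List Bool →. List Bool} (hU : Partrec U) :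
    ∃ R, IsEnumeration U R := by
  obtain ⟨c, hc⟩ := Nat.Partrec.Code.exists_code.1 hU
  let g : ℕ → ℕ → Option (List Bool × List Bool) := fun t x =>
    (Encodable.decode (α := List Bool) x).bind fun p =>
      -- Keeping only canonical codes leaves one index `x` for each program, so no program is listed
      -- twice.
      if Encodable.encode p = x then
        ((Nat.Partrec.Code.evaln t c x).bind fun y => Encodable.decode (α := List Bool) y).map
          fun s => (p, s)
      else none
  have hg : Primrec₂ g := by
    refine Primrec.option_bind (Primrec.decode.comp Primrec.snd) (Primrec.ite ?_ ?_
      (Primrec.const none))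
    · exact Primrec.eq.comp (Primrec.encode.comp Primrec.snd) (Primrec.snd.comp Primrec.fst)
    · refine Primrec.option_map (Primrec.option_bind ?_ (Primrec.decode.comp Primrec.snd)) ?_
      · exact Nat.Partrec.Code.primrec_evaln.comp
          (((Primrec.fst.comp Primrec.fst).pair (Primrec.const c)).pair
            (Primrec.snd.comp Primrec.fst))
      · exact (Primrec.snd.comp Primrec.fst).pair Primrec.snd
  have key : ∀ t x p s, g t x = some (p, s) → Encodable.encode p = x ∧ s ∈ U p := by
    intro t x p s h
    simp only [g, Option.bind_eq_some_iff] at h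
    obtain ⟨p', -, h⟩ := h
    split_ifs at h with hx
    simp only [Option.map_eq_some_iff, Option.bind_eq_some_iff, Prod.mk.injEq] at h
    obtain ⟨s', ⟨y, hy, hs'⟩, rfl, rfl⟩ := h
    refine ⟨hx, ?_⟩
    have := Nat.Partrec.Code.evaln_sound hy
    rw [hc, ← hx] at this
    simp only [Encodable.encodek, Part.coe_some, Part.bind_some, Part.mem_map_iff] at this
    obtain ⟨s'', hs'', rfl⟩ := this
    simpa using (by simpa using hs' : s'' = s') ▸ hs''
  refine ⟨fun t => (List.range t).filterMap (g t), ?_, ?_, ?_, ?_⟩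
  · exact Primrec.listFilterMap Primrec.list_range hg
  · intro t
    rw [List.map_filterMap]
    refine List.Nodup.filterMap ?_ List.nodup_range
    intro x x' p hp hp'
    simp only [Option.mem_def, Option.map_eq_some_iff, Prod.exists, exists_and_right,
      exists_eq_right] at hp hp'
    obtain ⟨s, hs⟩ := hp
    obtain ⟨s', hs'⟩ := hp'
    exact (key _ _ _ _ hs).1.symm.trans (key _ _ _ _ hs').1
  · rintro t ⟨p, s⟩ h
    obtain ⟨x, -, hx⟩ := List.mem_filterMap.1 h
    exact (key _ _ _ _ hx).2
  · intro p s hs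
    have : Encodable.encode s ∈ Nat.Partrec.Code.eval c (Encodable.encode p) := by
      rw [hc]
      simpa using hs
    obtain ⟨k, hk⟩ := Nat.Partrec.Code.evaln_complete.1 this
    refine ⟨k, fun t ht => List.mem_filterMap.2 ⟨Encodable.encode p, ?_, ?_⟩⟩
    · exact List.mem_range.2 ((Nat.Partrec.Code.evaln_bound hk).trans_le ht)
    · have := Nat.Partrec.Code.evaln_mono ht hk
      simp only [Option.mem_def] at this
      simp [g, this]

/-! ### Computable lower approximations of `D` and of the weights `2 ^ (-l / D)`. -/

/-- The natural number whose binary digits are those of `k` followed by `f 0, …, f (m - 1)`. -/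
def appendDigits (k : ℕ) (f : ℕ → Fin 2) : ℕ → ℕ
  | 0 => k
  | m + 1 => 2 * appendDigits k f m + f m

theorem computable_appendDigits (k : ℕ) {f : ℕ → Fin 2} (hf : Computable f) :
    Computable (appendDigits k f) := by
  have h1 : Computable fun x : ℕ × (ℕ × ℕ) => 2 * x.2.2 :=
    Primrec.nat_mul.to_comp.comp (Computable.const 2) (Computable.snd.comp Computable.snd)
  have h2 : Computable fun x : ℕ × (ℕ × ℕ) => ((f x.2.1 : Fin 2) : ℕ) :=
    Primrec.fin_val.to_comp.comp (hf.comp (Computable.fst.comp Computable.snd))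
  have h3 : Computable fun x : ℕ × (ℕ × ℕ) => 2 * x.2.2 + (f x.2.1 : ℕ) :=
    Primrec.nat_add.to_comp.comp h1 h2
  refine (Computable.nat_rec Computable.id (Computable.const k) h3.to₂).of_eq fun m => ?_
  induction m with
  | zero => rfl
  | succ m ih => simp only [id_eq, appendDigits] at ih ⊢; rw [ih]

/-- The remainder `D * 2 ^ m - a m` is the value of the shifted digit sequence, hence lies in `[0,
1]`. The value `1` occurs when the given expansion ends in ones, so the upper bound is not strict.
-/
theorem exists_dyadic_approx {D : ℝ} (h0 : 0 < D) (hD : IsComputableReal D) :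
    ∃ a : ℕ → ℕ, Computable a ∧ ∀ m, (a m : ℝ) ≤ D * 2 ^ m ∧ D * 2 ^ m ≤ a m + 1 := by
  obtain ⟨f, hf, hfD⟩ := hD
  have key : ∀ m : ℕ, (appendDigits ⌊D⌋₊ f m : ℝ) + Real.ofDigits (fun i => f (i + m))
      = D * 2 ^ m := by
    intro m
    induction m with
    | zero =>
      simp only [add_zero, pow_zero, mul_one]
      rw [hfD]
      have : ((⌊D⌋₊ : ℕ) : ℝ) = ((⌊D⌋ : ℤ) : ℝ) := by
        rw [← natCast_floor_eq_intCast_floor h0.le]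
      change ((⌊D⌋₊ : ℕ) : ℝ) + _ = _
      rw [this, Int.floor_add_fract]
    | succ m ih =>
      have h := Real.ofDigits_eq_sum_add_ofDigits (fun i => f (i + m)) 1
      simp only [Finset.sum_range_one, Real.ofDigitsTerm] at h
      rw [h] at ih
      have e : (fun i => f (i + 1 + m)) = fun i => f (i + (m + 1)) := by
        funext i; congr 1; ring
      have : (appendDigits ⌊D⌋₊ f (m + 1) : ℝ) = 2 * appendDigits ⌊D⌋₊ f m + (f m : ℕ) := by
        simp [appendDigits]
      rw [this, pow_succ, ← mul_assoc, ← ih, ← e]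
      norm_num
      ring
  refine ⟨_, computable_appendDigits ⌊D⌋₊ hf, fun m => ?_⟩
  have h1 := Real.ofDigits_nonneg (fun i => f (i + m))
  have h2 := Real.ofDigits_le_one (fun i => f (i + m))
  constructor <;> linarith [key m]

/-- For `am = (a, m)`, the largest `j ≤ 2 ^ m` with `j / 2 ^ m ≤ 2 ^ (-l * 2 ^ m / a)`. -/
def weight (am : ℕ × ℕ) (l : ℕ) : ℕ :=
  -- Raising to the power `a` turns the condition on real exponents into an inequality of naturals,
  -- which is decidable.
  Nat.findGreatest (fun j => j ^ am.1 * 2 ^ (l * 2 ^ am.2) ≤ 2 ^ (am.2 * am.1)) (2 ^ am.2)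

theorem primrec_weight : Primrec₂ weight := by
  refine Primrec.nat_findGreatest
    (primrec_pow.comp (Primrec.const 2) (Primrec.snd.comp Primrec.fst)) ?_
  refine Primrec.nat_le.comp ?_ ?_
  · refine Primrec.nat_mul.comp (primrec_pow.comp Primrec.snd
      (Primrec.fst.comp (Primrec.fst.comp Primrec.fst))) (primrec_pow.comp (Primrec.const 2) ?_)
    exact Primrec.nat_mul.comp (Primrec.snd.comp Primrec.fst)
      (primrec_pow.comp (Primrec.const 2) (Primrec.snd.comp (Primrec.fst.comp Primrec.fst)))
  · refine primrec_pow.comp (Primrec.const 2) ?_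
    exact Primrec.nat_mul.comp (Primrec.snd.comp (Primrec.fst.comp Primrec.fst))
      (Primrec.fst.comp (Primrec.fst.comp Primrec.fst))

theorem primrec_sum_weight :
    Primrec fun x : List ℕ × (ℕ × ℕ) => (x.1.map (weight x.2)).sum := by
  have h0 : Primrec₂ fun (x : List ℕ × (ℕ × ℕ)) (l : ℕ) => weight x.2 l :=
    (primrec_weight.comp (Primrec.snd.comp Primrec.fst) Primrec.snd).to₂
  exact primrec_list_sum.comp (Primrec.list_map Primrec.fst h0)

/-- Computable lower approximations of the weights `2 ^ (-l / D)`. -/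
theorem exists_weight_approx {D : ℝ} (h0 : 0 < D) (hD : IsComputableReal D) :
    ∃ w : ℕ → ℕ → ℕ, (Computable fun x : List ℕ × ℕ => (x.1.map (w x.2)).sum) ∧
      ∃ C : ℕ, ∀ m l : ℕ, (w m l : ℝ) ≤ 2 ^ m * (2 : ℝ) ^ (-(l : ℝ) / D) ∧
        2 ^ m * (2 : ℝ) ^ (-(l : ℝ) / D) ≤ w m l + C * (l + 1) := by
  obtain ⟨a, ha, haD⟩ := exists_dyadic_approx h0 hD
  -- In the error, `2 / D ^ 2` per unit of `l` pays for replacing `D` by `a m / 2 ^ m`, `1` for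
  -- rounding down, and `2 / D` for the small `m` at which `a m` may vanish.
  refine ⟨fun m => weight (a m, m), ?_, ⌈2 / D ^ 2 + 2 / D⌉₊ + 1, fun m l => ?_⟩
  · have h : Computable fun x : List ℕ × ℕ => (x.1, (a x.2, x.2)) :=
      Computable.fst.pair ((ha.comp Computable.snd).pair Computable.snd)
    exact (primrec_sum_weight.to_comp.comp h).of_eq fun _ => rfl
  have hC : 2 / D ^ 2 + 2 / D ≤ ((⌈2 / D ^ 2 + 2 / D⌉₊ : ℕ) : ℝ) := Nat.le_ceil _
  generalize ⌈2 / D ^ 2 + 2 / D⌉₊ = C at hC ⊢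
  have hD2 : 0 < 2 / D ^ 2 := by positivity
  have hD1 : 0 < 2 / D := by positivity
  have hl : (0 : ℝ) ≤ l := Nat.cast_nonneg l
  have hm : (0 : ℝ) < 2 ^ m := by positivity
  have hle1 : (2 : ℝ) ^ (-(l : ℝ) / D) ≤ 1 :=
    Real.rpow_le_one_of_one_le_of_nonpos (by norm_num)
      (div_nonpos_of_nonpos_of_nonneg (by linarith) h0.le)
  obtain ⟨hd1, hd2⟩ := haD m
  have hpos : 0 < a m → ∀ j : ℕ, (j ^ a m * 2 ^ (l * 2 ^ m) ≤ 2 ^ (m * a m) ↔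
      (j : ℝ) ≤ 2 ^ m * (2 : ℝ) ^ (-(l : ℝ) / (a m / 2 ^ m))) := by
    intro ham j
    have ham' : (0 : ℝ) < a m := by exact_mod_cast ham
    have e : ((2 : ℝ) ^ m * (2 : ℝ) ^ (-(l : ℝ) / (a m / 2 ^ m))) ^ a m * 2 ^ (l * 2 ^ m)
        = 2 ^ (m * a m) := by
      rw [mul_pow, ← pow_mul, mul_assoc, ← Real.rpow_natCast (_ ^ (_ : ℝ)), ← Real.rpow_mul
        (by norm_num), ← Real.rpow_natCast _ (l * 2 ^ m), ← Real.rpow_add (by norm_num)]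
      have : -(l : ℝ) / (a m / 2 ^ m) * (a m : ℕ) + ((l * 2 ^ m : ℕ) : ℝ) = 0 := by
        push_cast; field_simp; ring
      rw [this]; simp
    rw [← Nat.cast_le (α := ℝ)]
    push_cast
    rw [← e, mul_le_mul_iff_left₀ (by positivity),
      pow_le_pow_iff_left₀ (by positivity) (by positivity) ham.ne']
  constructor
  -- If `a m = 0`, the test reads `2 ^ (l * 2 ^ m) ≤ 1`: every `j` passes for `l = 0` and none for
  -- `l > 0`.
  · rcases Nat.eq_zero_or_pos (a m) with ham | ham
    · rcases Nat.eq_zero_or_pos l with rfl | hl0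
      · have : weight (a m, m) 0 ≤ 2 ^ m := Nat.findGreatest_le _
        simpa using (by exact_mod_cast this : (weight (a m, m) 0 : ℝ) ≤ 2 ^ m)
      · have : weight (a m, m) l = 0 := by
          refine Nat.findGreatest_eq_zero_iff.2 fun j _ _ => ?_
          have : l * 2 ^ m ≠ 0 := by positivity
          simp only [ham, pow_zero, one_mul, mul_zero, not_le]
          exact Nat.one_lt_two_pow this
        simp only [this, Nat.cast_zero]; positivity
    · have h := Nat.findGreatest_spec (P := fun j => j ^ a m * 2 ^ (l * 2 ^ m) ≤ 2 ^ (m * a m))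
        (Nat.zero_le (2 ^ m)) (by simp [ham.ne'])
      refine ((hpos ham _).1 h).trans ?_
      have ham' : (0 : ℝ) < a m := by exact_mod_cast ham
      gcongr 2 ^ m * ?_
      refine Real.rpow_le_rpow_of_exponent_le (by norm_num) ?_
      rw [neg_div, neg_div, neg_le_neg_iff]
      gcongr
      rwa [div_le_iff₀ hm]
  · push_cast
    rcases lt_or_ge ((2 : ℝ) ^ m) (2 / D) with hsm | hbig
    · nlinarith [Nat.cast_nonneg (α := ℝ) (weight (a m, m) l)]
    · have hDm : 2 ≤ D * 2 ^ m := by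
        rw [div_le_iff₀ h0] at hbig; linarith
      have ham' : (0 : ℝ) < a m := by linarith
      have ham : 0 < a m := by exact_mod_cast ham'
      set d : ℝ := a m / 2 ^ m with hd
      have hdm : d * 2 ^ m = a m := by rw [hd]; field_simp
      have hdpos : 0 < d := by positivity
      have h1 : 2 ^ m * (2 : ℝ) ^ (-(l : ℝ) / d) ≤ weight (a m, m) l + 1 := by
        by_contra! hlt
        have hP : (weight (a m, m) l + 1) ^ a m * 2 ^ (l * 2 ^ m) ≤ 2 ^ (m * a m) :=
          (hpos ham _).2 (by push_cast; exact hlt.le)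
        have hle : weight (a m, m) l + 1 ≤ 2 ^ m := by
          have : (2 : ℝ) ^ (-(l : ℝ) / d) ≤ 1 :=
            Real.rpow_le_one_of_one_le_of_nonpos (by norm_num)
              (div_nonpos_of_nonpos_of_nonneg (by linarith) hdpos.le)
          have : (weight (a m, m) l + 1 : ℝ) ≤ 2 ^ m := by nlinarith
          exact_mod_cast this
        exact Nat.not_succ_le_self _ (Nat.le_findGreatest (P := fun j =>
          j ^ a m * 2 ^ (l * 2 ^ m) ≤ 2 ^ (m * a m)) hle hP)
      set x : ℝ := (l : ℝ) / D with hx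
      set y : ℝ := (l : ℝ) / d with hy
      have hxy : x ≤ y := by
        rw [hx, hy]; gcongr; rw [hd, div_le_iff₀ hm]; exact hd1
      have h2 : (2 : ℝ) ^ (-(l : ℝ) / D) - (2 : ℝ) ^ (-(l : ℝ) / d) ≤ y - x := by
        rw [neg_div, neg_div, ← hx, ← hy]
        have e : (2 : ℝ) ^ (-y) = 2 ^ (-x) * 2 ^ (-(y - x)) := by
          rw [← Real.rpow_add (by norm_num)]; congr 1; ring
        have h3 : 1 - (y - x) ≤ (2 : ℝ) ^ (-(y - x)) := by
          rw [Real.rpow_def_of_pos (by norm_num)]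
          have := Real.add_one_le_exp (Real.log 2 * -(y - x))
          have := Real.log_two_lt_d9
          nlinarith
        have h4 : (2 : ℝ) ^ (-x) ≤ 1 := by
          rw [hx, ← neg_div]; exact hle1
        have h5 : (0 : ℝ) < 2 ^ (-x) := by positivity
        rw [e]
        nlinarith
      have h6 : 2 ^ m * (y - x) ≤ l * (2 / D ^ 2) := by
        have : y - x = l * (D - d) / (d * D) := by
          rw [hx, hy]; field_simp
        have h7 : 2 ^ m * (D - d) ≤ 1 := by nlinarith
        have h8 : D / 2 ≤ d := by
          rw [hd, le_div_iff₀ hm]; linarith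
        rw [this, ← mul_div_assoc, div_le_iff₀ (by positivity)]
        have h9 : 1 ≤ 2 / D ^ 2 * (d * D) := by
          rw [div_mul_eq_mul_div, le_div_iff₀ (by positivity)]; nlinarith
        calc 2 ^ m * (l * (D - d)) = l * (2 ^ m * (D - d)) := by ring
          _ ≤ l * (2 / D ^ 2 * (d * D)) :=
            mul_le_mul_of_nonneg_left (h7.trans h9) hl
          _ = _ := by ring
      nlinarith

/-! ### Partial sums, Kraft's inequality and tails of the series. -/

/-- The term of the program `p` in the series `Ω ^ D`. -/
noncomputable def mass (D : ℝ) (p : List Bool) : ℝ := (2 : ℝ) ^ (-(p.length : ℝ) / D)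

theorem mass_pos (D : ℝ) (p : List Bool) : 0 < mass D p := by unfold mass; positivity

theorem hasSum_omega {U : List Bool →. List Bool} {D : ℝ} (h : omega U D ≠ ⊤) :
    HasSum (fun p : U.Dom => mass D p) (omega U D).toReal := by
  have h1 := ENNReal.hasSum_toReal h
  unfold omega
  rw [ENNReal.tsum_toReal_eq fun _ => ENNReal.ofReal_ne_top]
  convert h1 using 2 with p
  · rw [ENNReal.toReal_ofReal (by positivity)]; rfl

theorem sum_mass_le_omega {U : List Bool →. List Bool} {D : ℝ} (h : omega U D ≠ ⊤)
    {F : Finset (List Bool)} (hF : ∀ p ∈ F, p ∈ U.Dom) :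
    ∑ p ∈ F, mass D p ≤ (omega U D).toReal := by
  classical
  rw [← Finset.sum_subtype_of_mem (p := fun p => p ∈ U.Dom) (mass D) hF]
  exact sum_le_hasSum _ (fun p _ => (mass_pos D p).le) (hasSum_omega h)

theorem exists_sum_mass_gt {U : List Bool →. List Bool} {D : ℝ} (h : omega U D ≠ ⊤) {x : ℝ}
    (hx : x < (omega U D).toReal) :
    ∃ F : Finset (List Bool), (∀ p ∈ F, p ∈ U.Dom) ∧ x < ∑ p ∈ F, mass D p := by
  obtain ⟨s, hs⟩ := ((hasSum_omega h).eventually (lt_mem_nhds hx)).exists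
  refine ⟨s.map (Function.Embedding.subtype _), ?_, by simpa using hs⟩
  intro p hp
  obtain ⟨q, -, rfl⟩ := Finset.mem_map.1 hp
  exact q.2

/-- The first words of two factorizations are prefixes of the same word, hence comparable, hence
equal. The empty word must be excluded, because `{[]}` is prefix-free but not uniquely decodable. -/
theorem PrefixFree.uniquelyDecodable {S : Set (List Bool)} (hS : PrefixFree S) (h : [] ∉ S) :
    InformationTheory.UniquelyDecodable S := by
  intro L₁
  induction L₁ with
  | nil =>
    intro L₂ _ h2 he
    cases L₂ with
    | nil => rfl
    | cons b L₂ =>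
      have : b = [] := (List.append_eq_nil_iff.1 (show b ++ L₂.flatten = [] from he.symm)).1
      exact absurd (this ▸ h2 b (by simp)) h
  | cons a L₁ ih =>
    intro L₂ h1 h2 he
    cases L₂ with
    | nil =>
      have : a = [] := (List.append_eq_nil_iff.1 (show a ++ L₁.flatten = [] from he)).1
      exact absurd (this ▸ h1 a (by simp)) h
    | cons b L₂ =>
      simp only [List.flatten_cons] at he
      have hab : a = b := by
        have ha : a <+: b ++ L₂.flatten := he ▸ List.prefix_append _ _
        rcases List.prefix_or_prefix_of_prefix ha (List.prefix_append _ _) with hp | hp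
        · exact hS a (h1 a (by simp)) b (h2 b (by simp)) hp
        · exact (hS b (h2 b (by simp)) a (h1 a (by simp)) hp).symm
      subst hab
      rw [ih L₂ (fun w hw => h1 w (by simp [hw])) (fun w hw => h2 w (by simp [hw]))
        (List.append_cancel_left he)]

theorem PrefixFree.sum_mass_le_one {S : Set (List Bool)} (hS : PrefixFree S)
    {F : Finset (List Bool)} (hF : ∀ p ∈ F, p ∈ S) : ∑ p ∈ F, mass 1 p ≤ 1 := by
  have hm : ∀ p, mass 1 p = (1 / (Fintype.card Bool : ℝ)) ^ p.length := by
    intro p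
    simp [mass, Real.rpow_neg]
  by_cases h : [] ∈ S
  -- The empty word is a prefix of everything, so here it is the only element of `S`.
  · have : F ⊆ {[]} := fun p hp =>
      Finset.mem_singleton.2 (hS [] h p (hF p hp) List.nil_prefix).symm
    refine (Finset.sum_le_sum_of_subset_of_nonneg this fun p _ _ => (mass_pos 1 p).le).trans ?_
    simp [mass]
  · rw [Finset.sum_congr rfl fun p _ => hm p]
    refine InformationTheory.kraft_mcmillan_inequality (PrefixFree.uniquelyDecodable ?_ ?_)
    · exact fun p hp q hq => hS p (hF p hp) q (hF q hq)
    · exact fun h' => h (hF _ h')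

theorem omega_ne_top {U : List Bool →. List Bool} (hU : PrefixFree U.Dom) {D : ℝ} (h0 : 0 < D)
    (h1 : D ≤ 1) : omega U D ≠ ⊤ := by
  refine ne_top_of_le_ne_top ENNReal.one_ne_top ?_
  unfold omega
  rw [ENNReal.tsum_eq_iSup_sum]
  refine iSup_le fun s => ?_
  rw [← ENNReal.ofReal_sum_of_nonneg fun _ _ => by positivity, ENNReal.ofReal_le_one]
  have h2 : ∑ p ∈ s.map (Function.Embedding.subtype _), mass 1 p ≤ 1 := by
    refine hU.sum_mass_le_one fun p hp => ?_
    obtain ⟨q, -, rfl⟩ := Finset.mem_map.1 hp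
    exact q.2
  rw [Finset.sum_map] at h2
  refine (Finset.sum_le_sum fun p _ => ?_).trans h2
  refine Real.rpow_le_rpow_of_exponent_le (by norm_num) ?_
  simp only [Function.Embedding.subtype_apply, neg_div, neg_le_neg_iff, div_one]
  rw [le_div_iff₀ h0]
  exact mul_le_of_le_one_right (Nat.cast_nonneg _) h1

/-- Write `x ^ r = x * x ^ (r - 1)` and bound each second factor by that of the whole sum. -/
theorem sum_rpow_le_rpow_sum {ι : Type*} (s : Finset ι) {f : ι → ℝ} (hf : ∀ i ∈ s, 0 ≤ f i)
    {r : ℝ} (hr : 1 ≤ r) : ∑ i ∈ s, f i ^ r ≤ (∑ i ∈ s, f i) ^ r := by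
  have hS : 0 ≤ ∑ i ∈ s, f i := Finset.sum_nonneg hf
  have e : ∀ x : ℝ, 0 ≤ x → x ^ r = x * x ^ (r - 1) := by
    intro x hx
    rcases hx.eq_or_lt with rfl | hx
    · simp [Real.zero_rpow (by linarith : r ≠ 0)]
    · rw [Real.rpow_sub_one hx.ne']; field_simp
  rw [e _ hS, Finset.sum_mul]
  refine Finset.sum_le_sum fun i hi => ?_
  rw [e _ (hf i hi)]
  refine mul_le_mul_of_nonneg_left ?_ (hf i hi)
  exact Real.rpow_le_rpow (hf i hi) (Finset.single_le_sum hf hi) (by linarith)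

/-- The tail of `Ω ^ D` is controlled by the corresponding tail of `Ω`. -/
theorem omega_sub_sum_le {U : List Bool →. List Bool} (hU : PrefixFree U.Dom) {D : ℝ}
    (h0 : 0 < D) (h1 : D ≤ 1) {F : Finset (List Bool)} (hF : ∀ p ∈ F, p ∈ U.Dom) :
    (omega U D).toReal - ∑ p ∈ F, mass D p
      ≤ ((omega U 1).toReal - ∑ p ∈ F, mass 1 p) ^ (1 / D) := by
  classical
  by_contra! hlt
  obtain ⟨G, hG, hGs⟩ := exists_sum_mass_gt (omega_ne_top hU h0 h1)
    (lt_sub_iff_add_lt.1 hlt)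
  have h2 : ∑ p ∈ G, mass D p ≤ ∑ p ∈ F, mass D p + ∑ p ∈ G \ F, mass D p := by
    rw [← Finset.sum_union Finset.disjoint_sdiff]
    refine Finset.sum_le_sum_of_subset_of_nonneg ?_ fun p _ _ => (mass_pos D p).le
    simp
  have h3 : ∑ p ∈ F, mass 1 p + ∑ p ∈ G \ F, mass 1 p ≤ (omega U 1).toReal := by
    rw [← Finset.sum_union Finset.disjoint_sdiff]
    refine sum_mass_le_omega (omega_ne_top hU one_pos le_rfl) fun p hp => ?_
    rcases Finset.mem_union.1 hp with hp | hp
    · exact hF p hp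
    · exact hG p (Finset.mem_sdiff.1 hp).1
  have h4 : ∑ p ∈ G \ F, mass D p = ∑ p ∈ G \ F, mass 1 p ^ (1 / D) := by
    refine Finset.sum_congr rfl fun p _ => ?_
    rw [mass, mass, ← Real.rpow_mul (by norm_num)]
    congr 1; ring
  have h5 := sum_rpow_le_rpow_sum (G \ F) (fun p _ => (mass_pos 1 p).le)
    ((one_le_div h0).2 h1)
  have h6 : (∑ p ∈ G \ F, mass 1 p) ^ (1 / D) ≤
      ((omega U 1).toReal - ∑ p ∈ F, mass 1 p) ^ (1 / D) :=
    Real.rpow_le_rpow (Finset.sum_nonneg fun p _ => (mass_pos 1 p).le) (by linarith)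
      (by positivity)
  linarith

/-! ### Bounding complexity by program lengths. -/

theorem coe_natCast_toEReal (n : ℕ) : (((n : ℕ∞) : ℝ≥0∞) : EReal) = ((n : ℝ) : EReal) := by
  rw [ENat.toENNReal_coe, ← ENNReal.ofReal_natCast, EReal.coe_ennreal_ofReal,
    max_eq_left (Nat.cast_nonneg n)]

theorem complexity_le {U : List Bool →. List Bool} {s q : List Bool} (h : s ∈ U q) {x : ℝ}
    (hx : (q.length : ℝ) ≤ x) :
    (((complexity U s : ℕ∞) : ℝ≥0∞) : EReal) ≤ (x : EReal) := by
  have h1 : complexity U s ≤ (q.length : ℕ∞) := iInf₂_le q h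
  have h2 : ((complexity U s : ℕ∞) : ℝ≥0∞) ≤ ((q.length : ℕ∞) : ℝ≥0∞) :=
    ENat.toENNReal_le.2 h1
  rw [← EReal.coe_ennreal_le_coe_ennreal_iff, coe_natCast_toEReal] at h2
  exact h2.trans (EReal.coe_le_coe_iff.2 hx)

theorem le_complexity {U : List Bool →. List Bool} {s : List Bool} {x : ℝ}
    (h : ∀ q, s ∈ U q → x ≤ q.length) :
    (x : EReal) ≤ (((complexity U s : ℕ∞) : ℝ≥0∞) : EReal) := by
  rcases eq_or_ne (complexity U s) ⊤ with ht | ht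
  · simp [ht]
  · have : ∃ q, s ∈ U q ∧ complexity U s = (q.length : ℕ∞) := by
      have e : complexity U s = ⨅ q : {q // s ∈ U q}, (q.1.length : ℕ∞) := by
        rw [complexity, iInf_subtype]
      have : Nonempty {q // s ∈ U q} := by
        rw [e] at ht
        exact ENat.iInf_natCast_ne_top.1 ht
      obtain ⟨q, hq⟩ := ENat.exists_eq_iInf fun q : {q // s ∈ U q} => (q.1.length : ℕ∞)
      exact ⟨q.1, q.2, e.trans hq.symm⟩
    obtain ⟨q, hq, hqe⟩ := this
    rw [hqe, coe_natCast_toEReal]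
    exact EReal.coe_le_coe_iff.2 (h q hq)

/-! ### Passing between digit words and floors. -/

/-- The number with the binary digits `l`. -/
def bitsVal (l : List Bool) : ℕ := l.foldl (fun x b => 2 * x + b.toNat) 0

/-- The last `n` binary digits of `v`. -/
def lowBits (n v : ℕ) : List Bool :=
  (List.range n).map fun i => decide (v / 2 ^ (n - 1 - i) % 2 = 1)

theorem primrec_bitsVal : Primrec bitsVal := by
  have h1 : Primrec fun y : List Bool × (ℕ × Bool) => 2 * y.2.1 :=
    Primrec.nat_mul.comp (Primrec.const 2) (Primrec.fst.comp Primrec.snd)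
  have h2 : Primrec fun y : List Bool × (ℕ × Bool) => y.2.2.toNat :=
    (Primrec.dom_finite Bool.toNat).comp (Primrec.snd.comp Primrec.snd)
  have h : Primrec₂ fun (_ : List Bool) (x : ℕ × Bool) => 2 * x.1 + x.2.toNat :=
    Primrec.nat_add.comp h1 h2
  exact Primrec.list_foldl Primrec.id (Primrec.const 0) h

theorem primrec_lowBits : Primrec₂ lowBits := by
  have h : Primrec₂ fun (x : ℕ × ℕ) (i : ℕ) => decide (x.2 / 2 ^ (x.1 - 1 - i) % 2 = 1) := by
    refine PrimrecPred.decide (p := fun y : (ℕ × ℕ) × ℕ =>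
      y.1.2 / 2 ^ (y.1.1 - 1 - y.2) % 2 = 1) ?_
    refine Primrec.eq.comp (Primrec.nat_mod.comp (Primrec.nat_div.comp
      (Primrec.snd.comp Primrec.fst) (primrec_pow.comp (Primrec.const 2) ?_)) (Primrec.const 2))
      (Primrec.const 1)
    exact Primrec.nat_sub.comp (Primrec.nat_sub.comp (Primrec.fst.comp Primrec.fst)
      (Primrec.const 1)) Primrec.snd
  exact Primrec.list_map (Primrec.list_range.comp Primrec.fst) h

theorem code_apply (x : ℝ) (i : ℕ) :
    code x i = decide (⌊Int.fract x * 2 ^ (i + 1)⌋₊ % 2 = 1) := by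
  simp only [code, Real.digits, Fin.ext_iff]
  simp

theorem floor_fract_mul (x : ℝ) (hx : 0 ≤ x) (n : ℕ) :
    ⌊x * 2 ^ n⌋₊ = ⌊x⌋₊ * 2 ^ n + ⌊Int.fract x * 2 ^ n⌋₊ := by
  have h : x * 2 ^ n = Int.fract x * 2 ^ n + ((⌊x⌋₊ * 2 ^ n : ℕ) : ℝ) := by
    push_cast
    rw [natCast_floor_eq_intCast_floor hx, ← add_mul, Int.fract_add_floor]
  rw [h, Nat.floor_add_natCast (by positivity), add_comm]

theorem bitsVal_pre_code (x : ℝ) (n : ℕ) :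
    bitsVal (pre (code x) n) = ⌊Int.fract x * 2 ^ n⌋₊ := by
  induction n with
  | zero => simp [pre, bitsVal, Nat.floor_eq_zero.2 (Int.fract_lt_one x)]
  | succ n ih =>
    have h1 : pre (code x) (n + 1) = pre (code x) n ++ [code x n] := by
      simp only [pre, List.ofFn_succ_last, Fin.val_castSucc, Fin.val_last]
    have h2 : ⌊Int.fract x * 2 ^ n⌋₊ = ⌊Int.fract x * 2 ^ (n + 1)⌋₊ / 2 := by
      rw [← Nat.floor_div_natCast]; congr 1; push_cast; ring
    have h3 : bitsVal (pre (code x) n ++ [code x n])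
        = 2 * bitsVal (pre (code x) n) + (code x n).toNat := by
      simp [bitsVal]
    rw [h1, h3, ih, h2, code_apply]
    rcases Nat.mod_two_eq_zero_or_one ⌊Int.fract x * 2 ^ (n + 1)⌋₊ with h | h <;> simp [h] <;> omega

/-- The integer part of `x` occupies only the digits of `⌊x * 2 ^ n⌋₊` above the lowest `n`, which
`lowBits` ignores. -/
theorem lowBits_floor (x : ℝ) (hx : 0 ≤ x) (n : ℕ) :
    lowBits n ⌊x * 2 ^ n⌋₊ = pre (code x) n := by
  refine List.ext_getElem (by simp [lowBits, pre]) fun i hi _ => ?_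
  have hi : i < n := by simpa [lowBits] using hi
  simp only [lowBits, List.getElem_map, List.getElem_range, pre, List.getElem_ofFn, code_apply]
  have h1 : ⌊x * 2 ^ n⌋₊ / 2 ^ (n - 1 - i) = ⌊x * 2 ^ (i + 1)⌋₊ := by
    have := Nat.floor_div_natCast (x * 2 ^ n) (2 ^ (n - 1 - i))
    rw [← this]
    congr 1
    push_cast
    rw [div_eq_iff (by positivity), mul_assoc, ← pow_add]
    congr 2; omega
  rw [h1, floor_fract_mul x hx, pow_succ, ← mul_assoc, Nat.mul_add_mod_self_right]

/-! ### Self-delimiting headers and simulation. -/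

/-- A word preceded by the unary self-delimiting code of a number. -/
def unary (a : ℕ) (w : List Bool) : List Bool := List.replicate a true ++ false :: w

theorem unary_prefix {a b : ℕ} {v w : List Bool} (h : unary a v <+: unary b w) :
    a = b ∧ v <+: w := by
  induction a generalizing b with
  | zero => cases b <;> simp_all [unary, List.replicate_succ]
  | succ a ih =>
    cases b with
    | zero => simp [unary, List.replicate_succ] at h
    | succ b =>
      simp only [unary, List.replicate_succ, List.cons_append, List.cons_prefix_cons,
        true_and] at h
      simpa using ih h

/-- A word preceded by a self-delimiting code of `n`. -/
def header (n : ℕ) (w : List Bool) : List Bool := unary n.unpair.1 (unary n.unpair.2 w)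

theorem header_prefix {m n : ℕ} {v w : List Bool} (h : header m v <+: header n w) :
    m = n ∧ v <+: w := by
  obtain ⟨h1, h⟩ := unary_prefix h
  obtain ⟨h2, h⟩ := unary_prefix h
  exact ⟨by rw [← Nat.pair_unpair m, ← Nat.pair_unpair n, h1, h2], h⟩

/-- Both coordinates of `Nat.unpair n` are at most `√n`; their unary codes therefore cost `o(n)`,
unlike a unary code of `n`. -/
theorem length_header_le (n : ℕ) (w : List Bool) :
    (header n w).length ≤ w.length + 2 * n.sqrt + 2 := by
  have h1 : n.unpair.1 ≤ n.sqrt ∧ n.unpair.2 ≤ n.sqrt := by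
    have := Nat.sqrt_le_add n
    unfold Nat.unpair
    simp only
    split_ifs <;> constructor <;> simp only <;> omega
  simp only [header, unary, List.length_append, List.length_replicate, List.length_cons]
  omega

theorem primrec_header : Primrec₂ header := by
  have h : Primrec₂ unary := Primrec.list_append.comp
    ((primrec_replicate true).comp Primrec.fst)
    (Primrec.list_cons.comp (Primrec.const false) Primrec.snd)
  exact h.comp (Primrec.fst.comp (Primrec.unpair.comp Primrec.fst))
    (h.comp (Primrec.snd.comp (Primrec.unpair.comp Primrec.fst)) Primrec.snd)

/-- An optimal computer simulates a partial recursive function of `n` and of a word of length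
`g n`, with an overhead of `2 √n + O(1)`. -/
theorem IsOptimalComputer.exists_program {U : List Bool →. List Bool} (hU : IsOptimalComputer U)
    {g : ℕ → ℕ} (hg : Computable g) {h : ℕ → List Bool →. List Bool} (hh : Partrec₂ h) :
    ∃ c : ℕ, ∀ n w s, w.length = g n → s ∈ h n w →
      ∃ q, s ∈ U q ∧ q.length ≤ g n + 2 * n.sqrt + c := by
  let d : List Bool → ℕ → Option (ℕ × List Bool) := fun p k =>
    (Encodable.decode (α := ℕ × List Bool) k).bind fun x =>
      bif decide (header x.1 x.2 = p) && decide (x.2.length = g x.1) then some x else none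
  have hd : Computable₂ d := by
    refine Computable.option_bind (Computable.decode.comp Computable.snd) ?_
    refine Computable.cond (c := fun y : (List Bool × ℕ) × (ℕ × List Bool) =>
      decide (header y.2.1 y.2.2 = y.1.1) && decide (y.2.2.length = g y.2.1)) ?_
      (Computable.option_some.comp Computable.snd) (Computable.const none)
    have h1 : Computable fun y : (List Bool × ℕ) × (ℕ × List Bool) =>
        decide (header y.2.1 y.2.2 = y.1.1) :=
      (Primrec.eq.decide.comp (primrec_header.comp (Primrec.fst.comp Primrec.snd)
        (Primrec.snd.comp Primrec.snd)) (Primrec.fst.comp Primrec.fst)).to_comp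
    have h2 : Computable fun y : (List Bool × ℕ) × (ℕ × List Bool) =>
        decide (y.2.2.length = g y.2.1) :=
      (Primrec.eq (α := ℕ)).decide.to_comp.comp (Computable.list_length.comp
        (Computable.snd.comp Computable.snd)) (hg.comp (Computable.fst.comp Computable.snd))
    exact Primrec.and.to_comp.comp h1 h2
  have hd_some : ∀ p k x, x ∈ d p k → header x.1 x.2 = p ∧ x.2.length = g x.1 := by
    intro p k x hx
    simp only [d, Option.mem_def, Option.bind_eq_some_iff, Bool.cond_eq_ite] at hx
    obtain ⟨y, -, hy⟩ := hx
    split_ifs at hy with hc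
    cases hy
    simpa using hc
  -- The machine finds the parse `header n w` of its input and runs `h n w`. The header fixes `n`,
  -- and `n` fixes the length of `w`, so the domain is prefix-free.
  let C : List Bool →. List Bool := fun p => (Nat.rfindOpt (d p)).bind fun x => h x.1 x.2
  have hC : IsComputer C := by
    constructor
    · exact (Partrec.rfindOpt hd).bind (hh.comp (Computable.fst.comp Computable.snd)
        (Computable.snd.comp Computable.snd)).to₂
    · have key : ∀ p ∈ C.Dom, ∃ x : ℕ × List Bool, header x.1 x.2 = p ∧ x.2.length = g x.1 := by
        intro p hp
        obtain ⟨s, hs⟩ := Part.dom_iff_mem.1 hp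
        obtain ⟨x, hx, -⟩ := Part.mem_bind_iff.1 hs
        obtain ⟨k, hk⟩ := Nat.rfindOpt_spec hx
        exact ⟨x, hd_some _ _ _ hk⟩
      intro p hp q hq hpq
      obtain ⟨x, rfl, hx⟩ := key p hp
      obtain ⟨y, rfl, hy⟩ := key q hq
      obtain ⟨h1, h2⟩ := header_prefix hpq
      rw [h1, h2.eq_of_length (by rw [hx, hy, h1])]
  obtain ⟨sim, hsim⟩ := hU.2 C hC
  refine ⟨2 + sim, fun n w s hw hs => ?_⟩
  have hdom : (Nat.rfindOpt (d (header n w))).Dom := by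
    refine Nat.rfindOpt_dom.2 ⟨Encodable.encode (n, w), (n, w), ?_⟩
    simp [d, hw]
  have hmem : (n, w) ∈ Nat.rfindOpt (d (header n w)) := by
    obtain ⟨x, hx⟩ := Part.dom_iff_mem.1 hdom
    obtain ⟨k, hk⟩ := Nat.rfindOpt_spec hx
    obtain ⟨h1, h2⟩ := hd_some _ _ _ hk
    obtain ⟨h3, h4⟩ := header_prefix (h1 ▸ List.prefix_rfl : header x.1 x.2 <+: header n w)
    have h5 := h4.eq_of_length (by rw [h2, hw, h3])
    have : x = (n, w) := Prod.ext h3 h5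
    exact this ▸ hx
  obtain ⟨q, hq, hql⟩ := hsim (header n w) s (Part.mem_bind_iff.2 ⟨_, hmem, hs⟩)
  refine ⟨q, hq, ?_⟩
  have := length_header_le n w
  omega

/-! ### Finding a stage from a lower bound on the sum. -/

/-- The programs that have halted by a given stage. -/
def halted (R : ℕ → List (List Bool × List Bool)) (t : ℕ) : Finset (List Bool) :=
  ((R t).map Prod.fst).toFinset

/-- The lengths of the programs that have halted by a given stage. -/
def haltedLengths (R : ℕ → List (List Bool × List Bool)) (t : ℕ) : List ℕ :=
  (R t).map fun x => x.1.length

/-- A bound for the error in the sum of the weights of the halted programs. -/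
def haltedSize (R : ℕ → List (List Bool × List Bool)) (t : ℕ) : ℕ :=
  ((haltedLengths R t).map fun l => l + 1).sum

theorem IsEnumeration.primrec_haltedLengths {U : List Bool →. List Bool}
    {R : ℕ → List (List Bool × List Bool)} (hR : IsEnumeration U R) :
    Primrec (haltedLengths R) :=
  Primrec.list_map hR.primrec
    (Primrec.list_length.comp (Primrec.fst.comp Primrec.snd)).to₂

theorem IsEnumeration.primrec_haltedSize {U : List Bool →. List Bool}
    {R : ℕ → List (List Bool × List Bool)} (hR : IsEnumeration U R) : Primrec (haltedSize R) :=
  primrec_list_sum.comp (Primrec.list_map hR.primrec_haltedLengths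
    (Primrec.succ.comp Primrec.snd).to₂)

theorem IsEnumeration.halted_dom {U : List Bool →. List Bool}
    {R : ℕ → List (List Bool × List Bool)} (hR : IsEnumeration U R) {t : ℕ} {p : List Bool}
    (hp : p ∈ halted R t) : p ∈ U.Dom := by
  simp only [halted, List.mem_toFinset, List.mem_map] at hp
  obtain ⟨x, hx, rfl⟩ := hp
  exact Part.dom_iff_mem.2 ⟨_, hR.sound t x hx⟩

theorem IsEnumeration.exists_subset_halted {U : List Bool →. List Bool}
    {R : ℕ → List (List Bool × List Bool)} (hR : IsEnumeration U R) {G : Finset (List Bool)}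
    (hG : ∀ p ∈ G, p ∈ U.Dom) : ∃ t, G ⊆ halted R t := by
  have h : ∀ p, ∃ t₀, p ∈ U.Dom → ∀ t, t₀ ≤ t → p ∈ halted R t := by
    intro p
    by_cases hp : p ∈ U.Dom
    · obtain ⟨s, hs⟩ := Part.dom_iff_mem.1 hp
      obtain ⟨t₀, ht₀⟩ := hR.complete p s hs
      refine ⟨t₀, fun _ t ht => ?_⟩
      simp only [halted, List.mem_toFinset, List.mem_map]
      exact ⟨_, ht₀ t ht, rfl⟩
    · exact ⟨0, fun h => absurd h hp⟩
  choose f hf using h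
  exact ⟨G.sup f, fun p hp => hf p (hG p hp) _ (Finset.le_sup hp)⟩

theorem IsEnumeration.sum_weight {U : List Bool →. List Bool}
    {R : ℕ → List (List Bool × List Bool)} (hR : IsEnumeration U R) {D : ℝ} {w : ℕ → ℕ → ℕ} {C : ℕ}
    (hw : ∀ m l : ℕ, (w m l : ℝ) ≤ 2 ^ m * (2 : ℝ) ^ (-(l : ℝ) / D) ∧
      2 ^ m * (2 : ℝ) ^ (-(l : ℝ) / D) ≤ w m l + C * (l + 1)) (t m : ℕ) :
    ((((haltedLengths R t).map (w m)).sum : ℕ) : ℝ) ≤ 2 ^ m * ∑ p ∈ halted R t, mass D p ∧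
    2 ^ m * ∑ p ∈ halted R t, mass D p ≤
      (((haltedLengths R t).map (w m)).sum : ℕ) + C * (haltedSize R t : ℕ) := by
  rw [halted, List.sum_toFinset _ (hR.nodup t), haltedSize, haltedLengths]
  induction R t with
  | nil => simp
  | cons x L ih =>
    obtain ⟨h1, h2⟩ := hw m x.1.length
    simp only [List.map_cons, List.sum_cons, Nat.cast_add, Nat.cast_one, mul_add, mass] at ih ⊢
    constructor <;> linarith [ih.1, ih.2]

/-- From a number `v ≤ 2 ^ n Ω ^ D` one computes a stage at which all but `2 ^ (-n)` of the
sum `v / 2 ^ n` has been enumerated. -/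
theorem IsEnumeration.exists_stage {U : List Bool →. List Bool}
    {R : ℕ → List (List Bool × List Bool)} (hR : IsEnumeration U R) {D : ℝ} (h0 : 0 < D)
    (hD : IsComputableReal D) (htop : omega U D ≠ ⊤) :
    ∃ stage : ℕ × ℕ →. ℕ, Partrec stage ∧
      (∀ v n : ℕ, (v : ℝ) ≤ (omega U D).toReal * 2 ^ n → (stage (v, n)).Dom) ∧
      ∀ v n t : ℕ, t ∈ stage (v, n) → (v : ℝ) < 2 ^ n * ∑ p ∈ halted R t, mass D p + 1 := by
  obtain ⟨w, hwc, C, hw⟩ := exists_weight_approx h0 hD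
  -- The search index codes a stage and a precision. The weights are lower approximations, so a
  -- successful test certifies the inequality for the true partial sum.
  let test : ℕ × ℕ → ℕ → Bool := fun x k =>
    decide (x.1 * 2 ^ k.unpair.2 <
      2 ^ x.2 * ((haltedLengths R k.unpair.1).map (w k.unpair.2)).sum + 2 ^ k.unpair.2)
  have htest : Computable₂ test := by
    have hm : Computable fun y : (ℕ × ℕ) × ℕ => 2 ^ y.2.unpair.2 :=
      (primrec_pow.comp (Primrec.const 2)
        (Primrec.snd.comp (Primrec.unpair.comp Primrec.snd))).to_comp
    have h1 : Computable fun y : (ℕ × ℕ) × ℕ => y.1.1 * 2 ^ y.2.unpair.2 :=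
      Primrec.nat_mul.to_comp.comp (Computable.fst.comp Computable.fst) hm
    have h2 : Computable fun y : (ℕ × ℕ) × ℕ => 2 ^ y.1.2 :=
      (primrec_pow.comp (Primrec.const 2) (Primrec.snd.comp Primrec.fst)).to_comp
    have h3 : Computable fun y : (ℕ × ℕ) × ℕ =>
        (haltedLengths R y.2.unpair.1, y.2.unpair.2) :=
      ((hR.primrec_haltedLengths.comp (Primrec.fst.comp (Primrec.unpair.comp Primrec.snd))).pair
        (Primrec.snd.comp (Primrec.unpair.comp Primrec.snd))).to_comp
    have h4 : Computable fun y : (ℕ × ℕ) × ℕ =>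
        ((haltedLengths R y.2.unpair.1).map (w y.2.unpair.2)).sum :=
      (hwc.comp h3).of_eq fun _ => rfl
    have h5 : Computable fun y : (ℕ × ℕ) × ℕ => 2 ^ y.1.2 *
        ((haltedLengths R y.2.unpair.1).map (w y.2.unpair.2)).sum + 2 ^ y.2.unpair.2 :=
      Primrec.nat_add.to_comp.comp (Primrec.nat_mul.to_comp.comp h2 h4) hm
    exact Primrec.nat_lt.decide.to_comp.comp h1 h5
  have htest_iff : ∀ v n t m : ℕ, test (v, n) (Nat.pair t m) = true ↔
      (v : ℝ) * 2 ^ m < 2 ^ n * (((haltedLengths R t).map (w m)).sum : ℕ) + 2 ^ m := by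
    intro v n t m
    simp only [test, Nat.unpair_pair, decide_eq_true_eq]
    rw [← Nat.cast_lt (α := ℝ)]
    push_cast
    rfl
  refine ⟨fun x => (Nat.rfind fun k => Part.some (test x k)).map fun k => k.unpair.1,
    ?_, ?_, ?_⟩
  · exact (Partrec.rfind htest.partrec₂).map
      (Primrec.fst.comp (Primrec.unpair.comp Primrec.snd)).to_comp.to₂
  · intro v n hv
    have hn : (0 : ℝ) < 2 ^ n := by positivity
    -- The slack `2 ^ (-n)` is split in two: half covers the programs not yet enumerated, half the
    -- rounding of the weights at precision `m`.
    obtain ⟨G, hG, hGs⟩ := exists_sum_mass_gt htop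
      (sub_lt_self (omega U D).toReal (by positivity : (0 : ℝ) < 1 / 2 / 2 ^ n))
    obtain ⟨t, ht⟩ := hR.exists_subset_halted hG
    have h1 : (omega U D).toReal - 1 / 2 / 2 ^ n < ∑ p ∈ halted R t, mass D p :=
      hGs.trans_le (Finset.sum_le_sum_of_subset_of_nonneg ht fun p _ _ => (mass_pos D p).le)
    obtain ⟨m, hm⟩ := pow_unbounded_of_one_lt (2 * (2 ^ n * (C * (haltedSize R t : ℝ))))
      (one_lt_two (α := ℝ))
    obtain ⟨-, h2⟩ := hR.sum_weight hw t m
    have h3 : (omega U D).toReal * 2 ^ n - 1 / 2 < 2 ^ n * ∑ p ∈ halted R t, mass D p := by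
      have := mul_lt_mul_of_pos_left h1 hn
      have e : 2 ^ n * ((omega U D).toReal - 1 / 2 / 2 ^ n)
          = (omega U D).toReal * 2 ^ n - 1 / 2 := by field_simp
      linarith
    have hmpos : (0 : ℝ) < 2 ^ m := by positivity
    have h4 : ((v : ℝ) - 1 / 2) * 2 ^ m < 2 ^ n * ∑ p ∈ halted R t, mass D p * 2 ^ m := by
      rw [← Finset.sum_mul, ← mul_assoc]
      exact mul_lt_mul_of_pos_right (by linarith) hmpos
    rw [← Finset.sum_mul] at h4
    have h5 := mul_le_mul_of_nonneg_left h2 hn.le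
    have : test (v, n) (Nat.pair t m) = true := by
      rw [htest_iff]
      nlinarith
    rw [Part.map_Dom]
    exact Nat.rfind_dom'.2 ⟨_, Part.mem_some_iff.2 this.symm, fun _ => trivial⟩
  · intro v n t ht
    obtain ⟨k, hk, rfl⟩ := (Part.mem_map_iff _).1 ht
    have h := Part.mem_some_iff.1 (Nat.rfind_spec hk)
    have h' := (htest_iff v n k.unpair.1 k.unpair.2).1 (by rw [Nat.pair_unpair]; exact h.symm)
    obtain ⟨h1, -⟩ := hR.sum_weight hw k.unpair.1 k.unpair.2
    have hm : (0 : ℝ) < 2 ^ k.unpair.2 := by positivity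
    have h2 := mul_le_mul_of_nonneg_left h1 (by positivity : (0 : ℝ) ≤ 2 ^ n)
    refine lt_of_mul_lt_mul_right ?_ hm.le
    nlinarith

/-! ### Weak Chaitin randomness. -/

/-- A word that is not among the outputs in a list of runs. -/
def freshWord (L : List (List Bool × List Bool)) : List Bool :=
  List.replicate ((L.map fun x => x.2.length).sum + 1) false

theorem primrec_freshWord : Primrec freshWord :=
  (primrec_replicate false).comp (Primrec.succ.comp (primrec_list_sum.comp
    (Primrec.list_map Primrec.id (Primrec.list_length.comp (Primrec.snd.comp Primrec.snd)).to₂)))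

theorem freshWord_ne {L : List (List Bool × List Bool)} {x : List Bool × List Bool}
    (hx : x ∈ L) : freshWord L ≠ x.2 := by
  intro h
  have h1 := congrArg List.length h
  have h2 := List.le_sum_of_mem (List.mem_map_of_mem (f := fun x => x.2.length) hx)
  simp only [freshWord, List.length_replicate] at h1 h2
  omega

theorem weaklyChaitinRandom_omega {U : List Bool →. List Bool}
    (hU : IsOptimalComputer U) {D : ℝ} (h0 : 0 < D) (h1 : D ≤ 1)
    (hD : IsComputableReal D) : WeaklyChaitinRandom U D (code (omega U D).toReal) := by
  have htop := omega_ne_top hU.1.2 h0 h1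
  obtain ⟨R, hR⟩ := exists_isEnumeration hU.1.1
  obtain ⟨stage, hs, hsdom, hsmem⟩ := hR.exists_stage h0 hD htop
  set Ω := (omega U D).toReal with hΩ
  have hΩ0 : 0 ≤ Ω := ENNReal.toReal_nonneg
  -- The digits determine Ω only modulo one, so the constant `⌊Ω⌋₊` is built into the machine. Its
  -- domain lies in that of `U` and is therefore prefix-free.
  let C : List Bool →. List Bool := fun q => (U q).bind fun s =>
    (stage (⌊Ω⌋₊ * 2 ^ s.length + bitsVal s, s.length)).map fun t => freshWord (R t)
  have hC : IsComputer C := by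
    constructor
    · have ha : Primrec fun s : List Bool =>
          (⌊Ω⌋₊ * 2 ^ s.length + bitsVal s, s.length) :=
        (Primrec.nat_add.comp (Primrec.nat_mul.comp (Primrec.const _)
          (primrec_pow.comp (Primrec.const 2) Primrec.list_length)) primrec_bitsVal).pair
          Primrec.list_length
      have hb : Partrec fun s : List Bool =>
          (stage (⌊Ω⌋₊ * 2 ^ s.length + bitsVal s, s.length)).map fun t => freshWord (R t) :=
        (hs.comp ha.to_comp).map
          ((primrec_freshWord.comp (hR.primrec.comp Primrec.snd)).to_comp.to₂)
      exact hU.1.1.bind (hb.comp Computable.snd).to₂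
    · intro p hp q hq hpq
      exact hU.1.2 p (show (C p).Dom from hp).of_bind q (show (C q).Dom from hq).of_bind hpq
  obtain ⟨sim, hsim⟩ := hU.2 C hC
  refine ⟨D + sim, fun n => le_complexity fun q hq => ?_⟩
  have hlen : (pre (code Ω) n).length = n := by simp [pre]
  have hv : ⌊Ω⌋₊ * 2 ^ n + bitsVal (pre (code Ω) n) = ⌊Ω * 2 ^ n⌋₊ := by
    rw [bitsVal_pre_code, floor_fract_mul Ω hΩ0]
  have hdom := hsdom _ n (Nat.floor_le (by positivity : 0 ≤ Ω * 2 ^ n))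
  obtain ⟨t, ht⟩ := Part.dom_iff_mem.1 hdom
  have hmem : freshWord (R t) ∈ C q := by
    refine Part.mem_bind_iff.2 ⟨_, hq, (Part.mem_map_iff _).2 ⟨t, ?_, rfl⟩⟩
    rw [hlen, hv]
    exact ht
  obtain ⟨p, hp, hpl⟩ := hsim q _ hmem
  have hpd : p ∈ U.Dom := Part.dom_iff_mem.2 ⟨_, hp⟩
  have hpn : p ∉ halted R t := by
    intro hpt
    simp only [halted, List.mem_toFinset, List.mem_map] at hpt
    obtain ⟨x, hx, rfl⟩ := hpt
    exact freshWord_ne hx (Part.mem_unique hp (hR.sound t x hx))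
  have h2 : ∑ p ∈ halted R t, mass D p + mass D p ≤ Ω := by
    classical
    rw [add_comm, ← Finset.sum_insert hpn]
    refine sum_mass_le_omega htop fun r hr => ?_
    rcases Finset.mem_insert.1 hr with rfl | hr
    · exact hpd
    · exact hR.halted_dom hr
  have h3 := hsmem _ _ _ ht
  have h4 := Nat.lt_floor_add_one (Ω * 2 ^ n)
  -- One unit is lost in the floor of `Ω * 2 ^ n`, the other in the choice of the stage.
  have h5 : 2 ^ n * mass D p < 2 := by
    have := mul_le_mul_of_nonneg_left h2 (by positivity : (0 : ℝ) ≤ 2 ^ n)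
    linarith
  have h6 : (n : ℝ) + -(p.length : ℝ) / D < 1 := by
    rw [mass, ← Real.rpow_natCast, ← Real.rpow_add (by norm_num)] at h5
    have : (2 : ℝ) ^ ((n : ℝ) + -(p.length : ℝ) / D) < 2 ^ (1 : ℝ) := by simpa using h5
    exact (Real.rpow_lt_rpow_left_iff (by norm_num)).1 this
  have h7 : (p.length : ℝ) ≤ q.length + sim := by exact_mod_cast hpl
  have h8 : D * (-(p.length : ℝ) / D) = -p.length := by field_simp
  have h9 := mul_lt_mul_of_pos_left h6 h0
  linarith [mul_add D n (-(p.length : ℝ) / D)]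

/-! ### Compressibility. -/

theorem exists_computable_linear {D : ℝ} (h0 : 0 < D) (hD : IsComputableReal D) :
    ∃ g : ℕ → ℕ, Computable g ∧ ∀ n : ℕ, D * n ≤ g n ∧ (g n : ℝ) ≤ D * n + 2 := by
  obtain ⟨a, ha, haD⟩ := exists_dyadic_approx h0 hD
  -- With `n` bits of `D` the product is off by at most `n / 2 ^ n ≤ 1`, and the division loses less
  -- than `1`; adding `2` gives an upper bound of `D * n`.
  refine ⟨fun n => n * a n / 2 ^ n + 2, ?_, fun n => ?_⟩
  · have h : Primrec fun x : ℕ × ℕ => x.1 * x.2 / 2 ^ x.1 + 2 :=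
      Primrec.nat_add.comp (Primrec.nat_div.comp (Primrec.nat_mul.comp Primrec.fst Primrec.snd)
        (primrec_pow.comp (Primrec.const 2) Primrec.fst)) (Primrec.const 2)
    exact (h.to_comp.comp (Computable.id.pair ha)).of_eq fun _ => rfl
  · obtain ⟨h1, h2⟩ := haD n
    have hn : (n : ℝ) ≤ 2 ^ n := by exact_mod_cast Nat.lt_two_pow_self.le
    have hp : (0 : ℝ) < 2 ^ n := by positivity
    have hn0 : (0 : ℝ) ≤ n := Nat.cast_nonneg n
    have h3 : ((n * a n / 2 ^ n : ℕ) : ℝ) * 2 ^ n ≤ n * a n := by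
      exact_mod_cast Nat.div_mul_le_self _ _
    have h4 : (n : ℝ) * a n < ((n * a n / 2 ^ n : ℕ) + 1) * 2 ^ n := by
      have := Nat.lt_div_mul_add (a := n * a n) (b := 2 ^ n) (by positivity)
      have h' : n * a n < (n * a n / 2 ^ n + 1) * 2 ^ n := by linarith
      exact_mod_cast h'
    have h5 := mul_le_mul_of_nonneg_left h1 hn0
    have h6 := mul_le_mul_of_nonneg_left h2 hn0
    rw [Nat.cast_add]
    generalize ((n * a n / 2 ^ n : ℕ) : ℝ) = z at *
    constructor
    · refine le_of_mul_le_mul_right ?_ hp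
      push_cast
      nlinarith
    · refine le_of_mul_le_mul_right ?_ hp
      push_cast
      nlinarith

theorem tendsto_sqrt_div (c : ℝ) :
    Tendsto (fun n : ℕ => (2 * (n.sqrt : ℝ) + c) / n) atTop (𝓝 0) := by
  have h1 : Tendsto (fun n : ℕ => c / (n : ℝ)) atTop (𝓝 0) :=
    tendsto_const_div_atTop_nhds_zero_nat c
  have h2 : Tendsto (fun n : ℕ => (n.sqrt : ℝ) / n) atTop (𝓝 0) := by
    have h3 : Tendsto (fun n : ℕ => (√(n : ℝ))⁻¹) atTop (𝓝 0) :=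
      (Real.tendsto_sqrt_atTop.comp tendsto_natCast_atTop_atTop).inv_tendsto_atTop
    refine squeeze_zero (fun n => by positivity) (fun n => ?_) h3
    rw [← Real.sqrt_div_self (x := (n : ℝ))]
    gcongr
    exact Real.nat_sqrt_le_real_sqrt
  have := (h2.const_mul 2).add h1
  simp only [mul_zero, add_zero] at this
  refine this.congr fun n => ?_
  ring

theorem compressible_omega {U : List Bool →. List Bool}
    (hU : IsOptimalComputer U) {D : ℝ} (h0 : 0 < D) (h1 : D ≤ 1)
    (hD : IsComputableReal D) : Compressible U D (code (omega U D).toReal) := by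
  have htop := omega_ne_top hU.1.2 h0 h1
  have htop1 := omega_ne_top hU.1.2 one_pos le_rfl
  have hone : IsComputableReal 1 := by
    refine ⟨fun _ => 0, Computable.const 0, ?_⟩
    simp [Real.ofDigits, Real.ofDigitsTerm]
  obtain ⟨R, hR⟩ := exists_isEnumeration hU.1.1
  obtain ⟨stage, hs, hsdom, hsmem⟩ := hR.exists_stage one_pos hone htop1
  obtain ⟨w, hwc, C, hw⟩ := exists_weight_approx h0 hD
  obtain ⟨g, hg, hgD⟩ := exists_computable_linear h0 hD
  have htail := fun t => omega_sub_sum_le hU.1.2 h0 h1 (F := halted R t) fun p => hR.halted_dom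
  set Ω := (omega U D).toReal with hΩ
  set Ω₁ := (omega U 1).toReal with hΩ₁
  have hΩ0 : 0 ≤ Ω := ENNReal.toReal_nonneg
  have hΩ₁0 : 0 ≤ Ω₁ := ENNReal.toReal_nonneg
  -- The extra `haltedSize R t` bits of precision keep the error of the weights at most `C` after
  -- the division, since `C * k ≤ C * 2 ^ k`.
  let z : ℕ → ℕ → ℕ := fun n t =>
    ((haltedLengths R t).map (w (n + haltedSize R t))).sum / 2 ^ haltedSize R t
  have hz : Computable₂ z := by
    have ha : Computable fun x : ℕ × ℕ => (haltedLengths R x.2, x.1 + haltedSize R x.2) :=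
      ((hR.primrec_haltedLengths.comp Primrec.snd).pair (Primrec.nat_add.comp Primrec.fst
        (hR.primrec_haltedSize.comp Primrec.snd))).to_comp
    have hb : Computable fun x : ℕ × ℕ =>
        ((haltedLengths R x.2).map (w (x.1 + haltedSize R x.2))).sum :=
      (hwc.comp ha).of_eq fun _ => rfl
    exact Primrec.nat_div.to_comp.comp hb (primrec_pow.comp (Primrec.const 2)
      (hR.primrec_haltedSize.comp Primrec.snd)).to_comp
  -- Each correction `r` gets its own machine, with its own constant; only the finitely many `r ≤ K`
  -- are used, so the largest of these constants suffices.
  have hprog : ∀ r : ℕ, ∃ c : ℕ, ∀ n (v s : List Bool), v.length = g n →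
      s ∈ (stage (⌊Ω₁⌋₊ * 2 ^ g n + bitsVal v, g n)).map (fun t => lowBits n (z n t + r)) →
      ∃ q, s ∈ U q ∧ q.length ≤ g n + 2 * n.sqrt + c := by
    intro r
    refine hU.exists_program hg (h := fun n v =>
      (stage (⌊Ω₁⌋₊ * 2 ^ g n + bitsVal v, g n)).map fun t => lowBits n (z n t + r)) ?_
    have hgn : Computable fun x : ℕ × List Bool => g x.1 := hg.comp Computable.fst
    have h2 : Computable fun x : ℕ × List Bool => 2 ^ g x.1 :=
      primrec_pow.to_comp.comp (Computable.const 2) hgn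
    have h3 : Computable fun x : ℕ × List Bool =>
        (⌊Ω₁⌋₊ * 2 ^ g x.1 + bitsVal x.2, g x.1) :=
      (Primrec.nat_add.to_comp.comp (Primrec.nat_mul.to_comp.comp (Computable.const _) h2)
        (primrec_bitsVal.to_comp.comp Computable.snd)).pair hgn
    have h4 : Computable fun y : (ℕ × List Bool) × ℕ => z y.1.1 y.2 + r :=
      Primrec.nat_add.to_comp.comp
        (hz.comp (Computable.fst.comp Computable.fst) Computable.snd) (Computable.const r)
    have h5 : Computable₂ fun (x : ℕ × List Bool) (t : ℕ) => lowBits x.1 (z x.1 t + r) :=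
      primrec_lowBits.to_comp.comp (Computable.fst.comp Computable.fst) h4
    exact (hs.comp h3).map h5
  choose c hc using hprog
  -- The three terms bound, in units of `2 ^ (-n)`, the loss in the division, the error of the
  -- weights and the tail of Ω^D.
  let K : ℕ := ⌈1 + C + (2 : ℝ) ^ (1 / D)⌉₊
  let c₀ : ℕ := (Finset.range (K + 1)).sup c
  refine ⟨fun n => 2 * (n.sqrt : ℝ) + (2 + c₀), tendsto_sqrt_div _, fun n => ?_⟩
  have hv : ⌊Ω₁⌋₊ * 2 ^ g n + bitsVal (pre (code Ω₁) (g n)) = ⌊Ω₁ * 2 ^ g n⌋₊ := by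
    rw [bitsVal_pre_code, floor_fract_mul Ω₁ hΩ₁0]
  have hdom := hsdom _ (g n) (Nat.floor_le (by positivity : 0 ≤ Ω₁ * 2 ^ g n))
  obtain ⟨t, ht⟩ := Part.dom_iff_mem.1 hdom
  have h3 := hsmem _ _ _ ht
  have h4 := Nat.lt_floor_add_one (Ω₁ * 2 ^ g n)
  have hsum1 : ∑ p ∈ halted R t, mass 1 p ≤ Ω₁ :=
    sum_mass_le_omega htop1 fun p => hR.halted_dom
  have hsumD : ∑ p ∈ halted R t, mass D p ≤ Ω :=
    sum_mass_le_omega htop fun p => hR.halted_dom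
  have h5 : Ω₁ - ∑ p ∈ halted R t, mass 1 p ≤ 2 ^ (1 - (g n : ℝ)) := by
    rw [Real.rpow_sub (by norm_num), Real.rpow_one, Real.rpow_natCast, le_div_iff₀ (by positivity)]
    linarith
  -- Since `g n ≥ D * n`, the power `1 / D` of the tail bound `2 ^ (1 - g n)` is at most `2 ^ (1 /
  -- D) * 2 ^ (-n)`.
  have h6 : Ω - ∑ p ∈ halted R t, mass D p ≤ 2 ^ (1 / D) / 2 ^ n := by
    refine (htail t).trans ((Real.rpow_le_rpow (by linarith) h5 (by positivity)).trans ?_)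
    rw [← Real.rpow_mul (by norm_num), ← Real.rpow_natCast, ← Real.rpow_sub (by norm_num)]
    refine Real.rpow_le_rpow_of_exponent_le (by norm_num) ?_
    have : (n : ℝ) ≤ g n / D := (le_div_iff₀ h0).2 (by linarith [(hgD n).1])
    have e : (1 - (g n : ℝ)) * (1 / D) = 1 / D - g n / D := by ring
    linarith
  obtain ⟨h7, h8⟩ := hR.sum_weight hw t (n + haltedSize R t)
  have hz1 : (z n t : ℝ) * 2 ^ haltedSize R t ≤
      (((haltedLengths R t).map (w (n + haltedSize R t))).sum : ℕ) := by
    exact_mod_cast Nat.div_mul_le_self _ _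
  have hz2 : ((((haltedLengths R t).map (w (n + haltedSize R t))).sum : ℕ) : ℝ) <
      (z n t + 1) * 2 ^ haltedSize R t := by
    have := Nat.lt_div_mul_add (a := ((haltedLengths R t).map (w (n + haltedSize R t))).sum)
      (b := 2 ^ haltedSize R t) (by positivity)
    have h' : ((haltedLengths R t).map (w (n + haltedSize R t))).sum
      < (z n t + 1) * 2 ^ haltedSize R t := by rw [add_mul, one_mul]; exact this
    exact_mod_cast h'
  have hk : (haltedSize R t : ℝ) ≤ 2 ^ haltedSize R t := by
    exact_mod_cast Nat.lt_two_pow_self.le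
  have hkpos : (0 : ℝ) < 2 ^ haltedSize R t := by positivity
  have hnpos : (0 : ℝ) < 2 ^ n := by positivity
  have hlow : (z n t : ℝ) ≤ Ω * 2 ^ n := by
    refine le_of_mul_le_mul_right ?_ hkpos
    have := mul_le_mul_of_nonneg_left hsumD (by positivity : (0 : ℝ) ≤ 2 ^ (n + haltedSize R t))
    calc _ ≤ _ := hz1
      _ ≤ _ := h7
      _ ≤ _ := this
      _ = _ := by rw [pow_add]; ring
  have hupp : Ω * 2 ^ n ≤ z n t + (1 + C + (2 : ℝ) ^ (1 / D)) := by
    have h9 : 2 ^ n * ∑ p ∈ halted R t, mass D p ≤ z n t + 1 + C := by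
      refine le_of_mul_le_mul_right ?_ hkpos
      have h10 := mul_le_mul_of_nonneg_left hk (Nat.cast_nonneg (α := ℝ) C)
      rw [pow_add] at h8
      linarith
    have h11 : (Ω - ∑ p ∈ halted R t, mass D p) * 2 ^ n ≤ 2 ^ (1 / D) :=
      (le_div_iff₀ hnpos).1 h6
    linarith
  have hfl1 : z n t ≤ ⌊Ω * 2 ^ n⌋₊ := Nat.le_floor hlow
  obtain ⟨r, hr⟩ := Nat.exists_eq_add_of_le hfl1
  have hrK : r ≤ K := by
    have h9 : ((⌊Ω * 2 ^ n⌋₊ : ℕ) : ℝ) ≤ Ω * 2 ^ n := Nat.floor_le (by positivity)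
    rw [hr] at h9
    push_cast at h9
    have h10 : (r : ℝ) ≤ K := (by linarith : (r : ℝ) ≤ _).trans (Nat.le_ceil _)
    exact_mod_cast h10
  obtain ⟨q, hq, hql⟩ := hc r n (pre (code Ω₁) (g n)) (pre (code Ω) n) (by simp [pre]) (by
    rw [hv]
    refine (Part.mem_map_iff _).2 ⟨t, ht, ?_⟩
    rw [← hr, lowBits_floor Ω hΩ0])
  refine complexity_le hq ?_
  have h9 : c r ≤ c₀ := Finset.le_sup (f := c) (Finset.mem_range.2 (by omega))
  have h10 : (q.length : ℝ) ≤ g n + 2 * n.sqrt + c₀ := by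
    exact_mod_cast hql.trans (by omega)
  linarith [(hgD n).2]

/-! ### Divergence for `D > 1`. -/

theorem omega_eq_top {U : List Bool →. List Bool}
    (hU : IsOptimalComputer U) {D : ℝ} (h1 : 1 < D) : omega U D = ⊤ := by
  have h0 : 0 < D := by linarith
  -- The machine that prints the word following its header gives every word of length `n` a program
  -- of length at most `n + 2√n + c`.
  obtain ⟨c, hc⟩ := hU.exists_program Computable.id (h := fun _ w => Part.some w)
    Computable.snd.partrec.to₂
  by_contra htop
  have hbound : ∀ n : ℕ, 0 < n → (2 : ℝ) ^ ((n : ℝ) * ((1 - 1 / D) - 1 / D * ((2 * n.sqrt + c) / n)))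
      ≤ (omega U D).toReal := by
    intro n hn
    have hq : ∀ f : Fin n → Bool, ∃ q, List.ofFn f ∈ U q ∧ q.length ≤ n + 2 * n.sqrt + c :=
      fun f => hc n (List.ofFn f) _ (by simp) (Part.mem_some _)
    choose q hqU hql using hq
    have hinj : Function.Injective q := fun f g hfg =>
      List.ofFn_injective (Part.mem_unique (hqU f) (hfg ▸ hqU g))
    have h2 := sum_mass_le_omega htop (F := Finset.univ.map ⟨q, hinj⟩) fun p hp => by
      obtain ⟨f, -, rfl⟩ := Finset.mem_map.1 hp
      exact Part.dom_iff_mem.2 ⟨_, hqU f⟩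
    rw [Finset.sum_map] at h2
    refine le_trans ?_ h2
    have h3 : ∀ f : Fin n → Bool,
        (2 : ℝ) ^ (-(n + 2 * n.sqrt + c : ℝ) / D) ≤ mass D (q f) := by
      intro f
      refine Real.rpow_le_rpow_of_exponent_le (by norm_num) ?_
      rw [neg_div, neg_div, neg_le_neg_iff]
      gcongr
      exact_mod_cast hql f
    refine le_trans (le_of_eq ?_) (Finset.sum_le_sum fun f _ => h3 f)
    rw [Finset.sum_const, Finset.card_univ, Fintype.card_fun, Fintype.card_bool, Fintype.card_fin,
      nsmul_eq_mul, Nat.cast_pow, Nat.cast_ofNat, ← Real.rpow_natCast, ← Real.rpow_add (by norm_num)]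
    congr 1
    have : (n : ℝ) ≠ 0 := by positivity
    field_simp
    ring
  have h2 : Tendsto (fun n : ℕ => (n : ℝ) * ((1 - 1 / D) - 1 / D * ((2 * n.sqrt + c) / n)))
      atTop atTop := by
    -- With `n` factored out, the remaining factor tends to `1 - 1 / D`, which is positive exactly
    -- because `D > 1`.
    refine Tendsto.atTop_mul_pos (C := 1 - 1 / D) ?_ tendsto_natCast_atTop_atTop ?_
    · rw [sub_pos, div_lt_one h0]; exact h1
    · simpa using ((tendsto_sqrt_div c).const_mul (1 / D)).const_sub (1 - 1 / D)
  obtain ⟨n, hn, hn0⟩ := ((((tendsto_rpow_atTop_of_base_gt_one 2 (by norm_num)).comp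
    h2).eventually_gt_atTop (omega U D).toReal).and
      (eventually_gt_atTop 0)).exists
  exact (hbound n hn0).not_gt hn

end AlgInfo

theorem mainTheorem2 (U : List Bool →. List Bool) (hU : AlgInfo.IsOptimalComputer U) (D : ℝ) :
    (0 < D → D ≤ 1 → AlgInfo.IsComputableReal D →
      AlgInfo.omega U D ≠ ⊤ ∧
      AlgInfo.WeaklyChaitinRandom U D (AlgInfo.code (AlgInfo.omega U D).toReal) ∧
      AlgInfo.Compressible U D (AlgInfo.code (AlgInfo.omega U D).toReal)) ∧
    (1 < D → AlgInfo.omega U D = ⊤) := by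
  exact ⟨fun h0 h1 hD => ⟨AlgInfo.omega_ne_top hU.1.2 h0 h1,
    AlgInfo.weaklyChaitinRandom_omega hU h0 h1 hD, AlgInfo.compressible_omega hU h0 h1 hD⟩,
    AlgInfo.omega_eq_top hU⟩
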